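/- **Theorem 1.3 (with its three companions; $A_n$ extensions of Liu's expansion formula).** Let $n\ge 1$, let $q\in\mathbb C$ with $0<|q|<1$, and write $(z)_\infty=\prod_{j\ge 0}(1-zq^j)$, $(z)_m=\prod_{0\le j<m}(1-zq^j)$ and $|\boldsymbol k|=k_1+\cdots+k_n$ for $\boldsymbol k\in\mathbb Z_{\ge 0}^n$; write $A=a_1\cdots a_n$ for $\boldsymbol a=(a_1,\dots,a_n)\in\mathbb C^n$. Let $\alpha,b\in\mathbb C$ with $\alpha\ne 1$, and let $x_1,\dots,x_n\in\mathbb C\setminus\{0\}$ satisfy $x_r/x_s\notin q^{\mathbb Z}$ for $r\neq s$. Put $$\Delta(\boldsymbol k)=\prod_{1\le r<s\le n}\frac{1-q^{k_r-k_s}x_r/x_s}{1-x_r/x_s},$$ and, for a function $w$ on $\mathbb Z_{\ge0}^n$, put $$S_w(\boldsymbol k)=\sum_{\substack{0\le m_r\le k_r\\ r=1,\dots,n}}\Delta(\boldsymbol m)\prod_{r,s=1}^n\frac{(q^{-k_s}x_r/x_s)_{m_r}}{(qx_r/x_s)_{m_r}}\,(\alpha q^{|\boldsymbol k|})_{|\boldsymbol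 m|}\,q^{\sum_{r=1}^n r m_r}\,w(\boldsymbol m),$$ $$T_w(\boldsymbol a;\boldsymbol k)=\Delta(\boldsymbol k)\prod_{r,s=1}^n\frac{(qx_r/(x_sa_s))_{k_r}}{(qx_r/x_s)_{k_r}}\cdot\frac{(1-\alpha q^{2|\boldsymbol k|})(\alpha)_{|\boldsymbol k|}}{(1-\alpha)(\alpha Aq^{1-n})_{|\boldsymbol k|}}\,A^{|\boldsymbol k|}\,q^{\sum_{r=1}^n(r-1)k_r-n|\boldsymbol k|}\,S_w(\boldsymbol k),$$ where $A^{|\boldsymbol k|}\prod_{r,s}(qx_r/(x_sa_s))_{k_r}$ is read as the polynomial $\prod_{r,s=1}^n\prod_{i=1}^{k_r}(a_s-q^{i}x_r/x_s)$ in $\boldsymbol a$ (so also if some $a_s=0$). Consider the following four choices of a function $L(\boldsymbol a)$ and of weights $w(\boldsymbol m)$. In (1) and (3), $f$ is any complex function of one complex variable; in (2) and (4), $f$ is any complex function of $n$ complex variables. In (1) and (2) suppose that $\alpha bq^j\ne1$ for all $j\ge0$; in (3) and (4) suppose that $\alpha bx_rq^j\neq1$ for all $r$ and all $j\ge0$.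 1. $\displaystyle L(\boldsymbol a)=f(\alpha Aq^{1-n})\frac{(\alpha q)_\infty(\alpha Ab/q^n)_\infty}{(\alpha Aq^{1-n})_\infty(\alpha b)_\infty}$ and $\displaystyle w(\boldsymbol m)=\frac{f(\alpha q^{1+|\boldsymbol m|})}{(\alpha b)_{|\boldsymbol m|}}$; 2. $\displaystyle L(\boldsymbol a)=f(\alpha a_1,\dots,\alpha a_n)\frac{(\alpha q)_\infty(\alpha Ab/q^n)_\infty}{(\alpha b)_\infty(\alpha Aq^{1-n})_\infty}$ and $\displaystyle w(\boldsymbol m)=\frac{f(\alpha q^{1+m_1},\dots,\alpha q^{1+m_n})}{(\alpha b)_{|\boldsymbol m|}}$; 3. $\displaystyle L(\boldsymbol a)=f(\alpha Aq^{1-n})\frac{(\alpha q)_\infty}{(\alpha Aq^{1-n})_\infty}\prod_{r=1}^n\frac{(\alpha a_rbx_r/q)_\infty}{(\alpha bx_r)_\infty}$ and $\displaystyle w(\boldsymbol m)=\frac{f(\alpha q^{1+|\boldsymbol m|})}{\prod_{r=1}^n(\alpha bx_r)_{m_r}}$; 4. $\displaystyle L(\boldsymbol a)=f(\alpha a_1,\dots,\alpha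 a_n)\frac{(\alpha q)_\infty}{(\alpha Aq^{1-n})_\infty}\prod_{r=1}^n\frac{(\alpha a_rbx_r/q)_\infty}{(\alpha bx_r)_\infty}$ and $\displaystyle w(\boldsymbol m)=\frac{f(\alpha q^{1+m_1},\dots,\alpha q^{1+m_n})}{\prod_{r=1}^n(\alpha bx_r)_{m_r}}$. In each of the four cases $$L(\boldsymbol a)=\sum_{\boldsymbol k\in\mathbb Z_{\ge0}^n}T_w(\boldsymbol a;\boldsymbol k)\qquad(*)$$ holds in each of the following two situations. * (Analytic case.) Let $D=\{\boldsymbol a:|a_r|<\rho_r,\ r=1,\dots,n\}$ with $\rho_1,\dots,\rho_n>0$ be a polydisc on which $(\alpha Aq^{1-n})_\infty$ has no zero, and suppose that the series $\sum_{\boldsymbol k}T_w(\boldsymbol a;\boldsymbol k)$ converges absolutely for every $\boldsymbol a\in D$ and that $L(\boldsymbol a)$ and the sum of this series are analytic functions of $\boldsymbol a\in D$. Then $(*)$ holds for every $\boldsymbol a\in D$. * (Terminating case.) Let $a_r=q^{N_r}$ with integers $N_r\ge1$ for $r=1,\dots,n$, and suppose that $(\alpha Aq^{1-n})_\infty\ne0$.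 Then $T_w(\boldsymbol a;\boldsymbol k)=0$ unless $k_r<N_r$ for all $r$, so the series is finite, and $(*)$ holds. -/

import Mathlib

open scoped BigOperators

noncomputable section

namespace Liu

/-- The `q`-shifted factorial `(z)_∞ = ∏_{j ≥ 0} (1 - z q^j)`. -/
def qPochInf (q z : ℂ) : ℂ := ∏' j : ℕ, (1 - z * q ^ j)

/-- The finite `q`-shifted factorial `(z)_m = ∏_{0 ≤ j < m} (1 - z q^j)`. -/
def qPoch (q z : ℂ) (m : ℕ) : ℂ := ∏ j ∈ Finset.range m, (1 - z * q ^ j)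

/-- `(z)_m (z q^m)_∞ = (z)_∞` for `|q| < 1`; so `(z)_m = (z)_∞ / (z q^m)_∞` whenever the
denominator does not vanish. -/
theorem qPoch_mul_qPochInf {q : ℂ} (hq : ‖q‖ < 1) (z : ℂ) (m : ℕ) :
    qPoch q z m * qPochInf q (z * q ^ m) = qPochInf q z := by
  have key : ∀ w : ℂ, Multipliable fun j : ℕ => 1 - w * q ^ j := by
    intro w
    have : Summable fun j : ℕ => ‖-(w * q ^ j)‖ := by
      simp only [norm_neg, norm_mul, norm_pow]
      exact (summable_geometric_of_lt_one (norm_nonneg _) hq).mul_left _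
    simpa [sub_eq_add_neg] using multipliable_one_add_of_summable this
  have h := Multipliable.prod_mul_tprod_nat_mul' (f := fun j : ℕ => 1 - z * q ^ j) (k := m)
    (by simpa [pow_add, mul_assoc, mul_comm, mul_left_comm] using key (z * q ^ m))
  unfold qPoch qPochInf
  rw [← h]
  congr 1
  apply tprod_congr
  intro j
  ring

variable {n : ℕ}

/-- `|k| = k_1 + ⋯ + k_n`. -/
def size (k : Fin n → ℕ) : ℕ := ∑ r, k r

/-- The `A_n` factor `∏_{r < s} (1 - q^{k_r - k_s} x_r / x_s) / (1 - x_r / x_s)`. -/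
def vand (q : ℂ) (x : Fin n → ℂ) (k : Fin n → ℕ) : ℂ :=
  ∏ r, ∏ s ∈ Finset.Ioi r,
    (1 - q ^ ((k r : ℤ) - (k s : ℤ)) * (x r / x s)) / (1 - x r / x s)

/-- The product `(a_1 ⋯ a_n)^{|k|} ∏_{r,s} (q x_r / (x_s a_s))_{k_r}`, written as a polynomial
in `a_1, …, a_n`, so that it has the right value (its continuous extension) also where some
`a_s` vanishes; see `outerFactor_eq` for the agreement where no `a_s` vanishes. -/
def outerFactor (q : ℂ) (x a : Fin n → ℂ) (k : Fin n → ℕ) : ℂ :=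
  ∏ r, ∏ s, ∏ i ∈ Finset.range (k r), (a s - q ^ (i + 1) * (x r / x s))

theorem outerFactor_eq (q : ℂ) (x a : Fin n → ℂ) (k : Fin n → ℕ) (ha : ∀ s, a s ≠ 0) :
    outerFactor q x a k =
      (∏ s, a s) ^ size k * ∏ r, ∏ s, qPoch q (q * x r / (x s * a s)) (k r) := by
  have h1 : (∏ s, a s) ^ size k = ∏ r, ∏ s, a s ^ k r := by
    rw [size, ← Finset.prod_pow_eq_pow_sum]
    exact Finset.prod_congr rfl fun r _ => (Finset.prod_pow _ _ _).symm
  rw [h1, outerFactor, ← Finset.prod_mul_distrib]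
  refine Finset.prod_congr rfl fun r _ => ?_
  rw [← Finset.prod_mul_distrib]
  refine Finset.prod_congr rfl fun s _ => ?_
  have h2 : a s ^ k r = ∏ _i ∈ Finset.range (k r), a s := by simp
  rw [h2, qPoch, ← Finset.prod_mul_distrib]
  refine Finset.prod_congr rfl fun i _ => ?_
  have := ha s
  by_cases hx : x s = 0
  · simp [hx]
  · field_simp
    ring

/-- The inner sum over `0 ≤ m_r ≤ k_r`:
`∑_m ∏_{r<s} (1 - q^{m_r-m_s} x_r/x_s)/(1 - x_r/x_s) ∏_{r,s} (q^{-k_s} x_r/x_s)_{m_r}/(q x_r/x_s)_{m_r}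
 · (α q^{|k|})_{|m|} q^{∑ r m_r} w(m)`.
(The index `r : Fin n` runs from `0` to `n - 1`, hence the factor `r + 1`.) -/
def innerSum (q α : ℂ) (x : Fin n → ℂ) (w : (Fin n → ℕ) → ℂ) (k : Fin n → ℕ) : ℂ :=
  ∑ m ∈ Finset.Iic k,
    vand q x m *
    (∏ r, ∏ s, qPoch q (q ^ (-(k s : ℤ)) * (x r / x s)) (m r) /
      qPoch q (q * (x r / x s)) (m r)) *
    qPoch q (α * q ^ size k) (size m) *
    q ^ (∑ r : Fin n, ((r : ℕ) + 1) * m r) *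
    w m

/-- The summand with outer index `k`:
`∏_{r<s} (1 - q^{k_r-k_s} x_r/x_s)/(1 - x_r/x_s) ∏_{r,s} (q x_r/(x_s a_s))_{k_r}/(q x_r/x_s)_{k_r}
 · (1 - α q^{2|k|}) (α)_{|k|} / ((1 - α) (α a_1⋯a_n q^{1-n})_{|k|})
 · (a_1⋯a_n)^{|k|} q^{∑ (r-1) k_r - n|k|}` times the inner sum. -/
def term (q α : ℂ) (x : Fin n → ℂ) (w : (Fin n → ℕ) → ℂ) (a : Fin n → ℂ)
    (k : Fin n → ℕ) : ℂ :=
  vand q x k *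
  (outerFactor q x a k / ∏ r, ∏ s, qPoch q (q * (x r / x s)) (k r)) *
  ((1 - α * q ^ (2 * size k)) * qPoch q α (size k) /
    ((1 - α) * qPoch q (α * (∏ s, a s) * q ^ (1 - (n : ℤ))) (size k))) *
  q ^ ((∑ r : Fin n, ((r : ℕ) : ℤ) * (k r : ℤ)) - (n : ℤ) * (size k : ℤ)) *
  innerSum q α x w k

/-- None of the factors of `(α a_1⋯a_n q^{1-n})_∞` vanishes. -/
def DenomNeZero (q α : ℂ) (a : Fin n → ℂ) : Prop :=
  ∀ j : ℕ, α * (∏ s, a s) * q ^ (1 - (n : ℤ)) * q ^ j ≠ 1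

/-- The expansion `L(a) = ∑_k term(a, k)` holds in both situations considered:
* on every polydisc around the origin (with arbitrary polyradius `ρ`) on which no denominator
  vanishes, both sides are analytic in `a_1, …, a_n` and the series converges absolutely;
* at every point `a_r = q^{N_r}` with positive integers `N_r` at which no denominator vanishes;
  and there the series terminates: the summand is zero unless `k_r < N_r` for all `r`. -/
def Expansion (q α : ℂ) (x : Fin n → ℂ) (w : (Fin n → ℕ) → ℂ) (L : (Fin n → ℂ) → ℂ) : Prop :=
  (∀ ρ : Fin n → ℝ, (∀ r, 0 < ρ r) →
    (∀ a : Fin n → ℂ, (∀ r, ‖a r‖ < ρ r) → DenomNeZero q α a) →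
    AnalyticOnNhd ℂ L {a | ∀ r, ‖a r‖ < ρ r} →
    (∀ a : Fin n → ℂ, (∀ r, ‖a r‖ < ρ r) → Summable fun k => ‖term q α x w a k‖) →
    AnalyticOnNhd ℂ (fun a => ∑' k, term q α x w a k) {a | ∀ r, ‖a r‖ < ρ r} →
    ∀ a : Fin n → ℂ, (∀ r, ‖a r‖ < ρ r) → HasSum (term q α x w a) (L a)) ∧
  (∀ N : Fin n → ℕ, (∀ r, 1 ≤ N r) →
    ∀ a : Fin n → ℂ, (∀ r, a r = q ^ N r) → DenomNeZero q α a →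
    (∀ k : Fin n → ℕ, (∃ r, N r ≤ k r) → term q α x w a k = 0) ∧
    HasSum (term q α x w a) (L a))

end Liu

end

/-! At `a_r = q^(M_r + 1)` the factor `outerFactor` becomes a product of `(q^(-M_s) x_r/x_s)_(k_r)`,
which vanishes unless `k ≤ M`. The right-hand side is then a finite double sum over `m ≤ k ≤ M`,
that is, a product of two lower triangular matrices applied to `w`. These matrices are inverse to
each other up to a diagonal factor (an `A_n` Bailey inversion, `orthogonality`), so the sum
collapses to `(αq)_|M| w(M)` (`sum_term_eq`). In each of the four cases `L` takes this value there,
because the quotients of infinite products telescope. This settles the terminating case. The points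
`q^N` accumulate at the origin in each coordinate, so the identity theorem carries equality to the
whole polydisc. Nothing about `f` is needed beyond its values at these points.

Both matrices are built from `multiBinom`, an `A_n` analogue of `(q^(-k))_m / (q)_m`. Partial
fractions give a recurrence that lowers `M` one unit at a time (`multiBinom_recurrence`). By
induction it yields a convolution formula whose constant depends only on `|k|`, `|m|` and `|M|`
(`multiBinom_convolution`). Grouping the orthogonality sum by `|k|` therefore leaves a one-variable
sum, which telescopes (`sum_telescope`). -/

namespace Liu

/-! ### Partial fractions and the identity theorem -/

/-- Partial fractions: Lagrange interpolation at `0` of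
`∏ (1 - Z_r u) - ∏ Z_r ∏ (Y_r - u)` from its values at the nodes `Y_r`. -/
theorem sum_partial_fraction {n : ℕ} (Y Z : Fin n → ℂ) (hY : ∀ r, Y r ≠ 0)
    (hinj : Function.Injective Y) :
    ∑ t, (∏ r, (1 - Z r * Y t)) / ∏ s ∈ Finset.univ.erase t, (1 - Y t / Y s) =
      1 - ∏ r, Z r * Y r := by
  classical
  open Polynomial in
  let P : ℂ[X] := ∏ r, (1 - C (Z r) * X) - C (∏ r, Z r) * ∏ r, (C (Y r) - X)
  have hd1 : ∀ r, (1 - C (Z r) * X : ℂ[X]).natDegree ≤ 1 := fun r => by compute_degree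
  have hd2 : ∀ r, (C (Y r) - X : ℂ[X]).natDegree ≤ 1 := fun r => by compute_degree
  have hP : P.degree < ((Finset.univ : Finset (Fin n)).card : WithBot ℕ) := by
    rw [Finset.card_univ, Fintype.card_fin, degree_lt_iff_coeff_zero]
    intro m hm
    have b1 : (∏ r, (1 - C (Z r) * X : ℂ[X])).natDegree ≤ n :=
      (natDegree_prod_le _ _).trans ((Finset.sum_le_sum fun r _ => hd1 r).trans (by simp))
    have b2 : (∏ r, (C (Y r) - X : ℂ[X])).natDegree ≤ n :=
      (natDegree_prod_le _ _).trans ((Finset.sum_le_sum fun r _ => hd2 r).trans (by simp))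
    -- The bound `n` on the degree is not enough: in degree `n` the two leading coefficients, both
    -- `(-1)^n ∏ Z_r`, cancel.
    rcases hm.eq_or_lt with rfl | hm
    · have c1 := coeff_prod_of_natDegree_le (s := Finset.univ) (fun r => (1 - C (Z r) * X : ℂ[X]))
        1 (by simpa using hd1)
      have c2 := coeff_prod_of_natDegree_le (s := Finset.univ) (fun r => (C (Y r) - X : ℂ[X]))
        1 (by simpa using hd2)
      simp only [Finset.card_univ, Fintype.card_fin, mul_one] at c1 c2
      simp only [P, coeff_sub, coeff_C_mul, c1, c2]
      simp [coeff_one, Finset.prod_neg]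
      ring
    · simp only [P, coeff_sub, coeff_C_mul]
      rw [coeff_eq_zero_of_natDegree_lt (by omega), coeff_eq_zero_of_natDegree_lt (by omega)]
      simp
  have h := congrArg (eval 0) (Lagrange.eq_interpolate (s := Finset.univ) (v := Y)
    hinj.injOn hP)
  have hl : eval 0 P = 1 - ∏ r, Z r * Y r := by
    simp [P, eval_prod, Finset.prod_mul_distrib]
  rw [← hl, h, Lagrange.interpolate_apply, eval_finsetSum]
  refine Finset.sum_congr rfl fun t _ => ?_
  rw [eval_mul, eval_C, div_eq_mul_inv, ← Finset.prod_inv_distrib]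
  congr 1
  · have : ∏ r, (Y r - Y t) = 0 := Finset.prod_eq_zero (Finset.mem_univ t) (sub_self _)
    simp [P, eval_prod, this]
  · rw [Lagrange.basis, eval_prod]
    refine Finset.prod_congr rfl fun s hs => ?_
    have hne : Y t - Y s ≠ 0 := sub_ne_zero.2 fun e => (Finset.ne_of_mem_erase hs) (hinj e).symm
    have hne' : 1 - Y t / Y s ≠ 0 := by
      intro e
      apply hne
      have := hY s
      field_simp at e
      linear_combination -e
    have h1 := hY s
    have h2 : Y s - Y t ≠ 0 := sub_ne_zero.2 (sub_ne_zero.1 hne).symm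
    simp only [Lagrange.basisDivisor, eval_mul, eval_C, eval_sub, eval_X]
    rw [inv_eq_one_div, inv_eq_one_div]
    field_simp
    ring

/-- Identity theorem: an analytic function on a polydisc around the origin that vanishes at all its
points of the form `(q^{N_1}, …, q^{N_n})` with `N_r ≥ 1` vanishes identically. -/
theorem eq_zero_of_eq_zero_qpow {n : ℕ} {q : ℂ} (hq0 : 0 < ‖q‖) (hq1 : ‖q‖ < 1)
    {ρ : Fin n → ℝ} (hρ : ∀ r, 0 < ρ r) {g : (Fin n → ℂ) → ℂ}
    (hg : AnalyticOnNhd ℂ g {a | ∀ r, ‖a r‖ < ρ r})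
    (hz : ∀ N : Fin n → ℕ, (∀ r, 1 ≤ N r) → (∀ r, ‖q ^ N r‖ < ρ r) → g (fun r => q ^ N r) = 0)
    (a : Fin n → ℂ) (ha : ∀ r, ‖a r‖ < ρ r) : g a = 0 := by
  classical
  -- `S` is the set of coordinates already free; the others are still powers of `q`. Freeing one
  -- more is the one-variable identity theorem at the limit point `0`, the centre of the disc.
  suffices H : ∀ S : Finset (Fin n), ∀ a : Fin n → ℂ, (∀ r, ‖a r‖ < ρ r) →
      (∀ r, r ∉ S → ∃ N : ℕ, 1 ≤ N ∧ a r = q ^ N) → g a = 0 from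
    H Finset.univ a ha fun r hr => absurd (Finset.mem_univ r) hr
  intro S
  induction S using Finset.induction_on with
  | empty =>
    intro a ha h
    choose N hN hN' using fun r => h r (Finset.notMem_empty r)
    have e : a = fun r => q ^ N r := funext hN'
    rw [e]
    exact hz N hN fun r => hN' r ▸ ha r
  | insert t S ht ih =>
    intro a ha h
    have hmem : ∀ z ∈ Metric.ball (0 : ℂ) (ρ t), ∀ r, ‖Function.update a t z r‖ < ρ r := by
      intro z hz' r
      by_cases hr : r = t
      · subst hr; simpa using hz'
      · simpa [hr] using ha r
    have hu : ∀ z, AnalyticAt ℂ (fun z : ℂ => Function.update a t z) z := by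
      intro z
      rw [analyticAt_pi_iff]
      intro r
      by_cases hr : r = t
      · subst hr; simpa using! analyticAt_id
      · simpa [hr] using! analyticAt_const
    have han : AnalyticOnNhd ℂ (fun z => g (Function.update a t z)) (Metric.ball 0 (ρ t)) :=
      fun z hz' => (hg _ (hmem z hz')).fun_comp (hu z)
    have hq : q ≠ 0 := norm_pos_iff.1 hq0
    have hlim : Filter.Tendsto (fun j : ℕ => q ^ (j + 1)) Filter.atTop (nhdsWithin 0 {0}ᶜ) := by
      refine tendsto_nhdsWithin_iff.2 ⟨?_, Filter.Eventually.of_forall fun j => pow_ne_zero _ hq⟩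
      exact (tendsto_pow_atTop_nhds_zero_of_norm_lt_one hq1).comp (Filter.tendsto_add_atTop_nat 1)
    have hev : ∀ᶠ j : ℕ in Filter.atTop, g (Function.update a t (q ^ (j + 1))) = 0 := by
      filter_upwards [(hlim.mono_right nhdsWithin_le_nhds).eventually
        (Metric.ball_mem_nhds 0 (hρ t))] with j hj
      refine ih _ (hmem _ hj) fun r hr => ?_
      by_cases hrt : r = t
      · subst hrt; exact ⟨j + 1, by omega, by simp⟩
      · simpa [hrt] using h r (by simp [hrt, hr])
    have := han.eqOn_zero_of_preconnected_of_frequently_eq_zero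
      (convex_ball (0 : ℂ) (ρ t)).isPreconnected (Metric.mem_ball_self (hρ t))
      (hlim.frequently hev.frequently)
    have h2 := this (show a t ∈ Metric.ball (0 : ℂ) (ρ t) by simpa using ha t)
    simpa using h2

/-! ### Finite and infinite `q`-shifted factorials -/

theorem qPochInf_ne_zero {q : ℂ} (hq : ‖q‖ < 1) {z : ℂ} (hz : ∀ j : ℕ, z * q ^ j ≠ 1) :
    qPochInf q z ≠ 0 := by
  have hs : Summable fun j : ℕ => ‖-(z * q ^ j)‖ := by
    simp only [norm_neg, norm_mul, norm_pow]
    exact (summable_geometric_of_lt_one (norm_nonneg _) hq).mul_left _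
  have := tprod_one_add_ne_zero_of_summable (f := fun j : ℕ => -(z * q ^ j))
    (fun j => by rw [← sub_eq_add_neg]; exact sub_ne_zero.2 (hz j).symm) hs
  simpa [qPochInf, sub_eq_add_neg] using this

theorem qPoch_ne_zero {q z : ℂ} {m : ℕ} (hz : ∀ j < m, z * q ^ j ≠ 1) : qPoch q z m ≠ 0 :=
  Finset.prod_ne_zero_iff.2 fun j hj => sub_ne_zero.2 (hz j (Finset.mem_range.1 hj)).symm

@[simp] theorem qPoch_zero (q z : ℂ) : qPoch q z 0 = 1 := by simp [qPoch]

theorem qPoch_succ (q z : ℂ) (m : ℕ) : qPoch q z (m + 1) = qPoch q z m * (1 - z * q ^ m) :=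
  Finset.prod_range_succ _ _

theorem qPoch_add (q z : ℂ) (m l : ℕ) : qPoch q z (m + l) = qPoch q z m * qPoch q (z * q ^ m) l := by
  simp only [qPoch, Finset.prod_range_add, pow_add, mul_assoc]

theorem qPoch_succ' (q z : ℂ) (m : ℕ) : qPoch q z (m + 1) = (1 - z) * qPoch q (z * q) m := by
  rw [add_comm, qPoch_add]; simp [qPoch]

theorem mul_qPoch_mul (q z : ℂ) (m : ℕ) :
    (1 - z) * qPoch q (z * q) m = (1 - z * q ^ m) * qPoch q z m := by
  rw [← qPoch_succ', qPoch_succ, mul_comm]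

theorem qPoch_eq_zero {q z : ℂ} {m j : ℕ} (hj : j < m) (h : z * q ^ j = 1) : qPoch q z m = 0 :=
  Finset.prod_eq_zero (Finset.mem_range.2 hj) (by rw [h, sub_self])

theorem zpow_ne_one {q : ℂ} (hq0 : 0 < ‖q‖) (hq1 : ‖q‖ < 1) {j : ℤ} (hj : j ≠ 0) : q ^ j ≠ 1 := by
  intro h
  have h2 := congrArg norm h
  rw [norm_zpow, norm_one] at h2
  exact hj ((zpow_eq_one_iff_right₀ hq0.le hq1.ne).1 h2)

/-- The evaluation behind the diagonal entries, one pair of indices at a time. -/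
theorem pair_eval {q z : ℂ} (hq : q ≠ 0) (hz : z ≠ 0) (a b : ℕ) :
    (1 - q ^ ((a : ℤ) - b) * z) * qPoch q (q ^ (-(b : ℤ)) * z) a *
        qPoch q (q ^ (-(a : ℤ)) * z⁻¹) b * q ^ b * q ^ (a * b) =
      (1 - z) * qPoch q (q * z) a * qPoch q (q * z⁻¹) b := by
  induction a with
  | zero =>
    have h := mul_qPoch_mul q z⁻¹ b
    have hqb : q ^ b ≠ 0 := pow_ne_zero _ hq
    simp only [Nat.cast_zero, zero_sub, qPoch_zero, neg_zero, zpow_zero, one_mul, mul_one,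
      zero_mul, pow_zero, zpow_neg, zpow_natCast]
    rw [mul_comm q]
    field_simp at h ⊢
    linear_combination h
  | succ a ih =>
    -- The new last factor is exactly the difference factor that the induction hypothesis needs.
    have h1 : qPoch q (q ^ (-(b : ℤ)) * z) (a + 1) =
        qPoch q (q ^ (-(b : ℤ)) * z) a * (1 - q ^ ((a : ℤ) - b) * z) := by
      rw [qPoch_succ, sub_eq_add_neg (a : ℤ), zpow_add₀ hq, zpow_natCast]; ring
    have h2 := mul_qPoch_mul q (q ^ (-((a : ℤ) + 1)) * z⁻¹) b
    have e1 : q ^ (-((a : ℤ) + 1)) * z⁻¹ * q = q ^ (-(a : ℤ)) * z⁻¹ := by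
      rw [neg_add, zpow_add₀ hq]; simp; field_simp
    rw [e1] at h2
    have hqa : q ^ a ≠ 0 := pow_ne_zero _ hq
    have hqb : q ^ b ≠ 0 := pow_ne_zero _ hq
    have e2 : (1 - q ^ (-((a : ℤ) + 1)) * z⁻¹ * q ^ b) * (q ^ (a + 1) * z) =
        - q ^ b * (1 - q ^ (((a + 1 : ℕ) : ℤ) - b) * z) := by
      push_cast
      rw [zpow_sub₀ hq, zpow_neg, zpow_natCast, zpow_add₀ hq, zpow_natCast, zpow_one]
      field_simp
      ring
    have e3 : (1 - q ^ (-((a : ℤ) + 1)) * z⁻¹) * (q ^ (a + 1) * z) = - (1 - q * z * q ^ a) := by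
      rw [zpow_neg, zpow_add₀ hq, zpow_natCast, zpow_one]
      field_simp
      ring
    rw [qPoch_succ q (q * z), h1]
    have e4 : q ^ (-(((a + 1 : ℕ) : ℤ))) = q ^ (-((a : ℤ) + 1)) := by push_cast; rfl
    rw [e4]
    have e5 : q ^ ((a + 1) * b) = q ^ (a * b) * q ^ b := by ring
    rw [e5]
    linear_combination (1 - q * z * q ^ a) * ih +
      (qPoch q (q ^ (-(b : ℤ)) * z) a * (1 - q ^ ((a : ℤ) - b) * z) *
        qPoch q (q ^ (-((a : ℤ) + 1)) * z⁻¹) b * q ^ b * q ^ (a * b)) * e2 +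
      (qPoch q (q ^ (-(b : ℤ)) * z) a * (1 - q ^ ((a : ℤ) - b) * z) * q ^ b * q ^ (a * b)) *
        (q ^ (a + 1) * z) * h2 -
      (qPoch q (q ^ (-(b : ℤ)) * z) a * (1 - q ^ ((a : ℤ) - b) * z) * q ^ b * q ^ (a * b)) *
        qPoch q (q ^ (-(a : ℤ)) * z⁻¹) b * e3

theorem self_eval {q : ℂ} (hq : q ≠ 0) (a : ℕ) :
    qPoch q (q ^ (-(a : ℤ))) a * (-1) ^ a * q ^ (a * (a + 1) / 2) = qPoch q q a := by
  induction a with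
  | zero => simp
  | succ a ih =>
    have e0 : q ^ (-((a + 1 : ℕ) : ℤ)) * q = q ^ (-(a : ℤ)) := by
      push_cast; rw [neg_add, zpow_add₀ hq]; simp; field_simp
    have e1 : (a + 1) * (a + 1 + 1) / 2 = a * (a + 1) / 2 + (a + 1) := by
      rw [show (a + 1) * (a + 1 + 1) = a * (a + 1) + (a + 1) * 2 by ring,
        Nat.add_mul_div_right _ _ two_pos]
    have e2 : (1 - q ^ (-((a + 1 : ℕ) : ℤ))) * q ^ (a + 1) = -(1 - q * q ^ a) := by
      rw [zpow_neg, zpow_natCast]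
      have := pow_ne_zero (a + 1) hq
      field_simp
      ring
    rw [qPoch_succ', e0, e1, pow_add q, pow_succ (-1 : ℂ), qPoch_succ q q]
    linear_combination (1 - q * q ^ a) * ih -
      qPoch q (q ^ (-(a : ℤ))) a * (-1) ^ a * q ^ (a * (a + 1) / 2) * e2

/-! ### The `A_n` binomial matrix and its recurrence -/

/-- The `A_n` extension of `(q^{-k})_m / (q)_m`. -/
noncomputable def multiBinom {n : ℕ} (q : ℂ) (x : Fin n → ℂ) (k m : Fin n → ℕ) : ℂ :=
  vand q x m *
    (∏ r, ∏ s, qPoch q (q ^ (-(k s : ℤ)) * (x r / x s)) (m r) /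
      qPoch q (q * (x r / x s)) (m r)) *
    q ^ (∑ r : Fin n, (r : ℕ) * m r)

theorem multiBinom_eq_zero {n : ℕ} {q : ℂ} (hq : q ≠ 0) {x : Fin n → ℂ} (hx0 : ∀ r, x r ≠ 0)
    {k m : Fin n → ℕ} (h : ¬ m ≤ k) : multiBinom q x k m = 0 := by
  rw [Pi.le_def] at h
  push Not at h
  obtain ⟨r, hr⟩ := h
  have h0 : qPoch q (q ^ (-(k r : ℤ)) * (x r / x r)) (m r) = 0 :=
    qPoch_eq_zero hr (by
      rw [div_self (hx0 r), mul_one, zpow_neg, zpow_natCast, inv_mul_cancel₀ (pow_ne_zero _ hq)])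
  have : ∏ r, ∏ s, qPoch q (q ^ (-(k s : ℤ)) * (x r / x s)) (m r) /
      qPoch q (q * (x r / x s)) (m r) = 0 :=
    Finset.prod_eq_zero (Finset.mem_univ r)
      (Finset.prod_eq_zero (Finset.mem_univ r) (by rw [h0, zero_div]))
  rw [multiBinom, this, mul_zero, zero_mul]

theorem size_sub_single {n : ℕ} (M : Fin n → ℕ) {t : Fin n} (ht : M t ≠ 0) :
    size (M - Pi.single t 1) + 1 = size M := by
  have h : M = (M - Pi.single t 1) + Pi.single t 1 := by
    funext r
    by_cases hr : r = t
    · subst hr; simp; omega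
    · simp [hr]
  conv_rhs => rw [h]
  simp [size, Finset.sum_add_distrib]

/-- Lowering `M t` affects only the factors with `s = t`, and each of those shifts its argument by
one power of `q`. -/
theorem multiBinom_step {n : ℕ} {q : ℂ} (hq : q ≠ 0) {x : Fin n → ℂ} (hx0 : ∀ r, x r ≠ 0)
    (M m : Fin n → ℕ) (t : Fin n) :
    (∏ r, (1 - x r * (q ^ M t * x t)⁻¹)) * multiBinom q x (M - Pi.single t 1) m =
      (∏ r, (1 - q ^ m r * x r * (q ^ M t * x t)⁻¹)) * multiBinom q x M m := by
  -- Here the subtraction is truncated, but both sides vanish: the left through its factor `r = t`,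
  -- the right through the same factor if `m t = 0` and through `multiBinom` otherwise.
  by_cases ht : M t = 0
  · have h1 : ∏ r, (1 - x r * (q ^ M t * x t)⁻¹) = 0 :=
      Finset.prod_eq_zero (Finset.mem_univ t) (by simp [ht, hx0 t])
    rw [h1, zero_mul]
    by_cases hm : m t = 0
    · have h2 : ∏ r, (1 - q ^ m r * x r * (q ^ M t * x t)⁻¹) = 0 :=
        Finset.prod_eq_zero (Finset.mem_univ t) (by simp [ht, hm, hx0 t])
      rw [h2, zero_mul]
    · rw [multiBinom_eq_zero hq hx0 (fun h => by have h3 : m t ≤ M t := h t; omega), mul_zero]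
  · have key : (∏ r, (1 - x r * (q ^ M t * x t)⁻¹)) *
        (∏ r, ∏ s, qPoch q (q ^ (-(((M - Pi.single t 1 : Fin n → ℕ) s : ℕ) : ℤ)) * (x r / x s)) (m r) /
          qPoch q (q * (x r / x s)) (m r)) =
        (∏ r, (1 - q ^ m r * x r * (q ^ M t * x t)⁻¹)) *
        (∏ r, ∏ s, qPoch q (q ^ (-(M s : ℤ)) * (x r / x s)) (m r) /
          qPoch q (q * (x r / x s)) (m r)) := by
      rw [← Finset.prod_mul_distrib, ← Finset.prod_mul_distrib]
      refine Finset.prod_congr rfl fun r _ => ?_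
      rw [← Finset.mul_prod_erase _ _ (Finset.mem_univ t),
        ← Finset.mul_prod_erase _ (fun s => qPoch q (q ^ (-(M s : ℤ)) * (x r / x s)) (m r) / _)
          (Finset.mem_univ t), ← mul_assoc, ← mul_assoc]
      congr 1
      · have h := mul_qPoch_mul q (q ^ (-(M t : ℤ)) * (x r / x t)) (m r)
        have e1 : q ^ (-(M t : ℤ)) * (x r / x t) * q =
            q ^ (-(((M - Pi.single t 1 : Fin n → ℕ) t : ℕ) : ℤ)) * (x r / x t) := by
          have : -(((M - Pi.single t 1 : Fin n → ℕ) t : ℕ) : ℤ) = -(M t : ℤ) + 1 := by simp; omega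
          rw [this, zpow_add₀ hq, zpow_one]; ring
        have e2 : q ^ (-(M t : ℤ)) * (x r / x t) = x r * (q ^ M t * x t)⁻¹ := by
          rw [zpow_neg, zpow_natCast, mul_inv]; ring
        rw [e1] at h
        rw [mul_assoc (q ^ m r), ← e2]
        linear_combination (qPoch q (q * (x r / x t)) (m r))⁻¹ * h
      · refine Finset.prod_congr rfl fun s hs => ?_
        simp [Finset.ne_of_mem_erase hs]
    unfold multiBinom
    linear_combination vand q x m * q ^ (∑ r : Fin n, (r : ℕ) * m r) * key

/-- Partial fractions with nodes `(q^(M_t) x_t)⁻¹` and `Z_r = q^(m_r) x_r`, with `multiBinom_step`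
absorbing the numerators. The coefficients on the left do not involve `m`, which is what lets the
recurrence be used twice in the convolution. -/
theorem multiBinom_recurrence {n : ℕ} {q : ℂ} (hq : q ≠ 0) {x : Fin n → ℂ} (hx0 : ∀ r, x r ≠ 0)
    (hx : ∀ r s, r ≠ s → ∀ j : ℤ, x r ≠ q ^ j * x s) (M m : Fin n → ℕ) :
    ∑ t, (∏ r, (1 - x r * (q ^ M t * x t)⁻¹)) /
        (∏ s ∈ Finset.univ.erase t, (1 - (q ^ M t * x t)⁻¹ / (q ^ M s * x s)⁻¹)) *
        multiBinom q x (M - Pi.single t 1) m =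
      (1 - q ^ ((size m : ℤ) - size M)) * multiBinom q x M m := by
  have hX : ∀ r, q ^ M r * x r ≠ 0 := fun r => mul_ne_zero (pow_ne_zero _ hq) (hx0 r)
  have h := sum_partial_fraction (fun t => (q ^ M t * x t)⁻¹) (fun r => q ^ m r * x r)
    (fun r => inv_ne_zero (hX r)) (by
      intro r s hrs
      by_contra hne
      refine hx r s hne ((M s : ℤ) - M r) ?_
      have h2 := inv_injective hrs
      have := pow_ne_zero (M r) hq
      rw [zpow_sub₀ hq, zpow_natCast, zpow_natCast]
      field_simp
      linear_combination h2)
  have h3 : ∏ r, q ^ m r * x r * (q ^ M r * x r)⁻¹ = q ^ ((size m : ℤ) - size M) := by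
    rw [zpow_sub₀ hq, zpow_natCast, zpow_natCast, size, size, ← Finset.prod_pow_eq_pow_sum,
      ← Finset.prod_pow_eq_pow_sum, ← Finset.prod_div_distrib]
    refine Finset.prod_congr rfl fun r _ => ?_
    have := hx0 r
    have := pow_ne_zero (M r) hq
    field_simp
  rw [← h3, ← h, Finset.sum_mul]
  refine Finset.sum_congr rfl fun t _ => ?_
  rw [div_mul_eq_mul_div, multiBinom_step hq hx0, div_mul_eq_mul_div]

theorem qPoch_ratio_ne_zero {n : ℕ} {q : ℂ} (hq0 : 0 < ‖q‖) (hq1 : ‖q‖ < 1) {x : Fin n → ℂ}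
    (hx0 : ∀ r, x r ≠ 0) (hx : ∀ r s, r ≠ s → ∀ j : ℤ, x r ≠ q ^ j * x s) (r s : Fin n) (m : ℕ) :
    qPoch q (q * (x r / x s)) m ≠ 0 := by
  have hq : q ≠ 0 := norm_pos_iff.1 hq0
  refine qPoch_ne_zero fun j _ h => ?_
  have h' : q ^ ((j : ℤ) + 1) * x r = x s := by
    have := hx0 s
    rw [zpow_add₀ hq, zpow_natCast, zpow_one]
    field_simp at h
    linear_combination h
  by_cases hrs : r = s
  · subst hrs
    refine zpow_ne_one hq0 hq1 (j := (j : ℤ) + 1) (by omega) ?_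
    exact mul_right_cancel₀ (hx0 r) (by rw [h', one_mul])
  · exact hx s r (Ne.symm hrs) _ h'.symm

/-- The factors `r = s` give the sign and the powers `M_r (M_r + 1) / 2` (`self_eval`); each pair `r
< s`, taken with its Vandermonde factor, gives the cross term `M_r M_s` (`pair_eval`). All
dependence on `x` cancels, so only `|M|` remains. -/
theorem multiBinom_self {n : ℕ} {q : ℂ} (hq0 : 0 < ‖q‖) (hq1 : ‖q‖ < 1) {x : Fin n → ℂ}
    (hx0 : ∀ r, x r ≠ 0) (hx : ∀ r s, r ≠ s → ∀ j : ℤ, x r ≠ q ^ j * x s) (M : Fin n → ℕ) :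
    multiBinom q x M M * ((-1) ^ size M * q ^ (size M * (size M + 1) / 2)) = 1 := by
  classical
  have hq : q ≠ 0 := norm_pos_iff.1 hq0
  have hsplit : ∀ f : Fin n → Fin n → ℂ, ∏ r, ∏ s, f r s =
      (∏ r, f r r) * ∏ r, ∏ s ∈ Finset.Ioi r, f r s * f s r := by
    intro f
    have := Finset.prod_prod_Ioi_mul_eq_prod_prod_off_diag (fun i j => f j i)
    rw [this, ← Finset.prod_mul_distrib]
    refine Finset.prod_congr rfl fun r _ => ?_
    rw [← Finset.mul_prod_erase _ _ (Finset.mem_univ r)]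
    congr 2
    ext; simp
  have hpow : size M * (size M + 1) / 2 =
      ∑ r, M r * (M r + 1) / 2 + ∑ r, ∑ s ∈ Finset.Ioi r, M r * M s := by
    have h1 : size M * size M = ∑ r, M r * M r + 2 * ∑ r, ∑ s ∈ Finset.Ioi r, M r * M s := by
      have := Finset.sum_sum_Ioi_add_eq_sum_sum_off_diag (fun i j => M j * M i)
      rw [size, Finset.sum_mul_sum, Finset.mul_sum]
      have e : ∀ i, 2 * ∑ s ∈ Finset.Ioi i, M i * M s =
          ∑ j ∈ Finset.Ioi i, (M i * M j + M j * M i) := by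
        intro i
        rw [Finset.mul_sum]
        exact Finset.sum_congr rfl fun j _ => by ring
      simp_rw [e, this]
      rw [← Finset.sum_add_distrib]
      refine Finset.sum_congr rfl fun r _ => ?_
      rw [← Finset.add_sum_erase _ _ (Finset.mem_univ r)]
      congr 1
      refine Finset.sum_congr (by ext; simp) fun _ _ => rfl
    have h2 : ∀ a : ℕ, 2 * (a * (a + 1) / 2) = a * a + a := fun a => by
      rw [Nat.mul_div_cancel' (Nat.even_mul_succ_self a).two_dvd]; ring
    have h3 : 2 * ∑ r, M r * (M r + 1) / 2 = ∑ r, M r * M r + size M := by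
      rw [Finset.mul_sum, size, ← Finset.sum_add_distrib]
      exact Finset.sum_congr rfl fun r _ => h2 _
    have := h2 (size M)
    omega
  -- With indices starting at `0`, exactly `s` of them lie below `s`.
  have hsum : q ^ (∑ r : Fin n, (r : ℕ) * M r) = ∏ r, ∏ s ∈ Finset.Ioi r, q ^ M s := by
    have := Finset.prod_comm' (s := Finset.univ) (t := fun r : Fin n => Finset.Ioi r)
      (t' := Finset.univ) (s' := fun s : Fin n => Finset.Iio s) (f := fun _ s => q ^ M s)
      (by simp)
    rw [this, ← Finset.prod_pow_eq_pow_sum]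
    refine Finset.prod_congr rfl fun s _ => ?_
    rw [Finset.prod_const, Fin.card_Iio, ← pow_mul, mul_comm]
  have hsign : (-1 : ℂ) ^ size M = ∏ r, (-1) ^ M r := (Finset.prod_pow_eq_pow_sum _ _ _).symm
  have hq2 : q ^ (size M * (size M + 1) / 2) =
      (∏ r, q ^ (M r * (M r + 1) / 2)) * ∏ r, ∏ s ∈ Finset.Ioi r, q ^ (M r * M s) := by
    rw [hpow, pow_add, ← Finset.prod_pow_eq_pow_sum, ← Finset.prod_pow_eq_pow_sum]
    congr 1
    exact Finset.prod_congr rfl fun r _ => (Finset.prod_pow_eq_pow_sum _ _ _).symm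
  rw [multiBinom, hsplit, hsum, hsign, hq2, vand]
  have hd : ∀ r, qPoch q (q ^ (-(M r : ℤ)) * (x r / x r)) (M r) /
      qPoch q (q * (x r / x r)) (M r) * ((-1) ^ M r * q ^ (M r * (M r + 1) / 2)) = 1 := by
    intro r
    have h1 := qPoch_ratio_ne_zero hq0 hq1 hx0 hx r r (M r)
    have h2 := self_eval hq (M r)
    rw [div_self (hx0 r), mul_one] at h1 ⊢
    rw [mul_one, div_mul_eq_mul_div, div_eq_one_iff_eq h1]
    linear_combination h2
  have ho : ∀ r, ∀ s ∈ Finset.Ioi r,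
      (1 - q ^ ((M r : ℤ) - (M s : ℤ)) * (x r / x s)) / (1 - x r / x s) *
      (qPoch q (q ^ (-(M s : ℤ)) * (x r / x s)) (M r) / qPoch q (q * (x r / x s)) (M r) *
        (qPoch q (q ^ (-(M r : ℤ)) * (x s / x r)) (M s) / qPoch q (q * (x s / x r)) (M s))) *
      q ^ M s * q ^ (M r * M s) = 1 := by
    intro r s hs
    have hrs : r ≠ s := (Finset.mem_Ioi.1 hs).ne
    have h1 := qPoch_ratio_ne_zero hq0 hq1 hx0 hx r s (M r)
    have h2 := qPoch_ratio_ne_zero hq0 hq1 hx0 hx s r (M s)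
    have h3 := pair_eval hq (div_ne_zero (hx0 r) (hx0 s)) (M r) (M s)
    have h4 : 1 - x r / x s ≠ 0 := by
      intro h
      refine hx r s hrs 0 ?_
      have := hx0 s
      field_simp at h
      simp
      linear_combination -h
    rw [inv_div] at h3
    refine Eq.trans ?_ ((div_eq_one_iff_eq (mul_ne_zero (mul_ne_zero h4 h1) h2)).2 h3)
    simp only [div_eq_mul_inv, mul_inv]
    ring
  have hd' := Finset.prod_congr (rfl : (Finset.univ : Finset (Fin n)) = _) fun r _ => hd r
  have ho' := Finset.prod_congr (rfl : (Finset.univ : Finset (Fin n)) = _) fun r _ =>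
    Finset.prod_congr rfl (ho r)
  simp only [Finset.prod_mul_distrib, Finset.prod_const_one] at hd' ho' ⊢
  have h := congrArg₂ (fun u v : ℂ => u * v) hd' ho'
  linear_combination h

/-! ### Convolution of the binomial matrix with itself -/

/-- The constant in the convolution identity for `multiBinom`. -/
noncomputable def convCoeff (q : ℂ) (l K d : ℕ) : ℂ :=
  ∏ j ∈ Finset.range d, (1 - q ^ ((l : ℤ) - K - 1 - j)) / (1 - q ^ (-(j : ℤ) - 1))

/-- Induction on `d = |M| - K`: the recurrence lowers `M` in the left factor, the induction
hypothesis sums over `k`, and the same recurrence restores `M`. The fixed box `B` keeps the range of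
summation independent of `M`. -/
theorem multiBinom_convolution {n : ℕ} {q : ℂ} (hq0 : 0 < ‖q‖) (hq1 : ‖q‖ < 1) {x : Fin n → ℂ}
    (hx0 : ∀ r, x r ≠ 0) (hx : ∀ r s, r ≠ s → ∀ j : ℤ, x r ≠ q ^ j * x s) (B m : Fin n → ℕ)
    (K d : ℕ) : ∀ M ≤ B, size M = K + d →
    ∑ k ∈ Finset.Iic B with size k = K, multiBinom q x M k * multiBinom q x k m =
      ((-1) ^ K * q ^ (K * (K + 1) / 2))⁻¹ * convCoeff q (size m) K d * multiBinom q x M m := by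
  have hq : q ≠ 0 := norm_pos_iff.1 hq0
  induction d with
  | zero =>
    intro M hMB hM
    rw [Finset.sum_eq_single M]
    · have h := multiBinom_self hq0 hq1 hx0 hx M
      rw [hM, add_zero] at h
      rw [eq_inv_of_mul_eq_one_left h]
      simp [convCoeff]
    · intro k hk hne
      rw [multiBinom_eq_zero hq hx0, zero_mul]
      intro hle
      have hs : size k = size M := by rw [(Finset.mem_filter.1 hk).2, hM, add_zero]
      exact hne (funext fun r =>
        (Finset.sum_eq_sum_iff_of_le fun i _ => hle i).1 hs r (Finset.mem_univ r))
    · intro h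
      exact absurd (Finset.mem_filter.2 ⟨Finset.mem_Iic.2 hMB, by simpa using hM⟩) h
  | succ d ih =>
    intro M hMB hM
    set U : Fin n → ℂ := fun t => (∏ r, (1 - x r * (q ^ M t * x t)⁻¹)) /
      (∏ s ∈ Finset.univ.erase t, (1 - (q ^ M t * x t)⁻¹ / (q ^ M s * x s)⁻¹)) with hU
    have hrec : ∀ m', ∑ t, U t * multiBinom q x (M - Pi.single t 1) m' =
        (1 - q ^ ((size m' : ℤ) - size M)) * multiBinom q x M m' :=
      multiBinom_recurrence hq hx0 hx M
    -- Where `M t = 0` nothing can be lowered and the induction hypothesis does not apply; the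
    -- coefficient vanishes there.
    have hU0 : ∀ t, M t = 0 → U t = 0 := fun t ht => by
      rw [hU]
      dsimp only
      rw [Finset.prod_eq_zero (Finset.mem_univ t) (by simp [ht, hx0 t]), zero_div]
    have e : (K : ℤ) - size M = -(d : ℤ) - 1 := by rw [hM]; push_cast; ring
    have e' : (size m : ℤ) - size M = (size m : ℤ) - K - 1 - d := by rw [hM]; push_cast; ring
    have hne : 1 - q ^ (-(d : ℤ) - 1) ≠ 0 :=
      sub_ne_zero.2 (zpow_ne_one hq0 hq1 (by omega)).symm
    apply mul_left_cancel₀ hne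
    have hl : (1 - q ^ (-(d : ℤ) - 1)) *
        ∑ k ∈ Finset.Iic B with size k = K, multiBinom q x M k * multiBinom q x k m =
        ∑ t, U t * ∑ k ∈ Finset.Iic B with size k = K,
          multiBinom q x (M - Pi.single t 1) k * multiBinom q x k m := by
      simp_rw [Finset.mul_sum]
      rw [Finset.sum_comm]
      refine Finset.sum_congr rfl fun k hk => ?_
      have := hrec k
      rw [(Finset.mem_filter.1 hk).2, e] at this
      rw [← mul_assoc, ← this, Finset.sum_mul]
      exact Finset.sum_congr rfl fun t _ => by ring
    rw [hl]
    have hr : ∀ t, U t * ∑ k ∈ Finset.Iic B with size k = K,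
          multiBinom q x (M - Pi.single t 1) k * multiBinom q x k m =
        ((-1) ^ K * q ^ (K * (K + 1) / 2))⁻¹ * convCoeff q (size m) K d *
          (U t * multiBinom q x (M - Pi.single t 1) m) := by
      intro t
      by_cases ht : M t = 0
      · rw [hU0 t ht]; ring
      · rw [ih _ (tsub_le_self.trans hMB) (by have := size_sub_single M ht; omega)]
        ring
    rw [Finset.sum_congr rfl fun t _ => hr t, ← Finset.mul_sum, hrec m, e']
    have hc : convCoeff q (size m) K (d + 1) * (1 - q ^ (-(d : ℤ) - 1)) =
        convCoeff q (size m) K d * (1 - q ^ ((size m : ℤ) - K - 1 - d)) := by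
      rw [convCoeff, Finset.prod_range_succ, mul_assoc, div_mul_cancel₀ _ hne, ← convCoeff]
    linear_combination -((-1) ^ K * q ^ (K * (K + 1) / 2))⁻¹ * multiBinom q x M m * hc

/-! ### Telescoping and orthogonality -/

/-- The telescoping sum behind the orthogonality relation for a single variable. -/
theorem sum_telescope {q α : ℂ} {l L : ℕ} (τ : ℕ → ℂ) (h0 : τ 0 * (1 - q ^ l) = 0)
    (hτ : ∀ K < L, τ (K + 1) * (q ^ l - q ^ (K + 1)) = τ K * (q ^ L - q ^ K))
    (hD : ∀ j : ℕ, α * q ^ (L + 1) * q ^ j ≠ 1) (J : ℕ) (hJ : J ≤ L) :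
    (∑ K ∈ Finset.range (J + 1), (1 - α * q ^ (2 * K)) * qPoch q α (K + l) /
        qPoch q (α * q ^ (L + 1)) K * τ K) * (q ^ L - q ^ l) =
      qPoch q α (J + l + 1) / qPoch q (α * q ^ (L + 1)) J * τ J * (q ^ L - q ^ J) := by
  induction J with
  | zero =>
    simp only [zero_add, Finset.range_one, Finset.sum_singleton, mul_zero, pow_zero, qPoch_zero,
      qPoch_succ]
    linear_combination qPoch q α l * (1 - α * q ^ L) * h0
  | succ J ih =>
    rw [Finset.sum_range_succ, add_mul, ih (by omega)]
    have h1 : qPoch q (α * q ^ (L + 1)) J ≠ 0 := qPoch_ne_zero fun j _ => hD j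
    have h2 : 1 - α * q ^ (L + 1) * q ^ J ≠ 0 := sub_ne_zero.2 (hD J).symm
    have h3 : J + 1 + l + 1 = (J + l + 1) + 1 := by omega
    have h4 : J + 1 + l = J + l + 1 := by omega
    rw [h3, h4, qPoch_succ q (α * q ^ (L + 1)) J, qPoch_succ q α (J + l + 1)]
    have := hτ J (by omega)
    rw [mul_assoc _ (τ J), ← this]
    rw [div_mul_eq_mul_div, div_mul_eq_mul_div, div_mul_eq_mul_div, div_mul_eq_mul_div,
      div_mul_eq_mul_div, div_add_div _ _ h1 (mul_ne_zero h1 h2),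
      div_eq_div_iff (mul_ne_zero h1 (mul_ne_zero h1 h2)) (mul_ne_zero h1 h2)]
    ring

/-- This is the hypothesis `hτ` of `sum_telescope` for the weights that the convolution produces. -/
theorem convCoeff_step {q : ℂ} (hq0 : 0 < ‖q‖) (hq1 : ‖q‖ < 1) {l L K : ℕ} (hK : K < L) :
    ((-1) ^ (K + 1) * q ^ ((K + 1) * (K + 1 + 1) / 2))⁻¹ * q ^ (L * (K + 1)) *
        convCoeff q l (K + 1) (L - (K + 1)) * (q ^ l - q ^ (K + 1)) =
      ((-1) ^ K * q ^ (K * (K + 1) / 2))⁻¹ * q ^ (L * K) * convCoeff q l K (L - K) *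
        (q ^ L - q ^ K) := by
  have hq : q ≠ 0 := norm_pos_iff.1 hq0
  obtain ⟨d, rfl⟩ : ∃ d, L = K + 1 + d := ⟨L - (K + 1), by omega⟩
  have e1 : K + 1 + d - (K + 1) = d := by omega
  have e2 : K + 1 + d - K = d + 1 := by omega
  have e3 : (K + 1) * (K + 1 + 1) / 2 = K * (K + 1) / 2 + (K + 1) := by
    rw [show (K + 1) * (K + 1 + 1) = K * (K + 1) + (K + 1) * 2 by ring,
      Nat.add_mul_div_right _ _ two_pos]
  have hne : 1 - q ^ (-(d : ℤ) - 1) ≠ 0 :=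
    sub_ne_zero.2 (zpow_ne_one hq0 hq1 (by omega)).symm
  have hc : convCoeff q l K (d + 1) * (1 - q ^ (-(d : ℤ) - 1)) =
      convCoeff q l (K + 1) d * (1 - q ^ ((l : ℤ) - K - 1)) := by
    simp only [convCoeff, Finset.prod_div_distrib]
    rw [Finset.prod_range_succ' (fun j : ℕ => 1 - q ^ ((l : ℤ) - K - 1 - j)),
      Finset.prod_range_succ (fun j : ℕ => 1 - q ^ (-(j : ℤ) - 1))]
    have : ∀ j : ℕ, (l : ℤ) - K - 1 - (j + 1 : ℕ) = (l : ℤ) - (K + 1 : ℕ) - 1 - j := fun j => by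
      push_cast; ring
    simp only [this, Nat.cast_zero, sub_zero]
    rw [div_mul_eq_mul_div, div_mul_eq_mul_div, mul_div_mul_right _ _ hne]
  have h1 : q ^ (K + 1 + d) - q ^ K = q ^ (K + 1 + d) * (1 - q ^ (-(d : ℤ) - 1)) := by
    have : q ^ (-(d : ℤ) - 1) = (q ^ (d + 1))⁻¹ := by
      rw [← zpow_natCast, ← zpow_neg]; congr 1; push_cast; ring
    rw [this]
    have := pow_ne_zero (d + 1) hq
    field_simp
    ring
  have h2 : q ^ l - q ^ (K + 1) = - q ^ (K + 1) * (1 - q ^ ((l : ℤ) - K - 1)) := by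
    have : q ^ ((l : ℤ) - K - 1) = q ^ l / q ^ (K + 1) := by
      rw [← zpow_natCast, ← zpow_natCast, ← zpow_sub₀ hq]; congr 1; push_cast; ring
    rw [this]
    have := pow_ne_zero (K + 1) hq
    field_simp
    ring
  rw [e1, e2, e3, h1, h2, pow_add q (K * (K + 1) / 2), pow_succ (-1 : ℂ)]
  have h5 : (-1 : ℂ) ^ K ≠ 0 := pow_ne_zero _ (by norm_num)
  have h6 := pow_ne_zero (K * (K + 1) / 2) hq
  have h7 := pow_ne_zero (K + 1) hq
  have h8 : ((-1 : ℂ) ^ K * -1 * (q ^ (K * (K + 1) / 2) * q ^ (K + 1)))⁻¹ * - q ^ (K + 1) =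
      ((-1) ^ K * q ^ (K * (K + 1) / 2))⁻¹ := by
    rw [mul_inv, mul_inv, mul_inv, mul_inv]
    field_simp
  have h9 : q ^ ((K + 1 + d) * (K + 1)) = q ^ ((K + 1 + d) * K) * q ^ (K + 1 + d) := by
    rw [← pow_add]; rfl
  rw [h9]
  linear_combination q ^ ((K + 1 + d) * K) * q ^ (K + 1 + d) * convCoeff q l (K + 1) d *
    (1 - q ^ ((l : ℤ) - K - 1)) * h8 - ((-1) ^ K * q ^ (K * (K + 1) / 2))⁻¹ *
    q ^ ((K + 1 + d) * K) * q ^ (K + 1 + d) * hc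

theorem innerSum_eq {n : ℕ} (q α : ℂ) (x : Fin n → ℂ) (w : (Fin n → ℕ) → ℂ) (k : Fin n → ℕ) :
    innerSum q α x w k = ∑ m ∈ Finset.Iic k,
      multiBinom q x k m * q ^ size m * qPoch q (α * q ^ size k) (size m) * w m := by
  refine Finset.sum_congr rfl fun m _ => ?_
  have : ∑ r : Fin n, ((r : ℕ) + 1) * m r = ∑ r : Fin n, (r : ℕ) * m r + size m := by
    rw [size, ← Finset.sum_add_distrib]
    exact Finset.sum_congr rfl fun r _ => by ring
  rw [this, pow_add, multiBinom]
  ring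

theorem prod_mul_zpow {n : ℕ} {q : ℂ} (hq : q ≠ 0) (α : ℂ) {a : Fin n → ℂ} {M : Fin n → ℕ}
    (ha : ∀ s, a s = q ^ (M s + 1)) :
    α * (∏ s, a s) * q ^ (1 - (n : ℤ)) = α * q ^ (size M + 1) := by
  have h : ∏ s, a s = q ^ (size M + n) := by
    rw [Finset.prod_congr rfl fun s _ => ha s, Finset.prod_pow_eq_pow_sum,
      Finset.sum_add_distrib]
    simp [size]
  rw [h, mul_assoc, ← zpow_natCast, ← zpow_add₀ hq, ← zpow_natCast]
  congr 2
  push_cast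
  ring

/-- At these points `q x_r/(x_s a_s) = q^(-M_s) x_r/x_s`, and `a_1⋯a_n = q^(|M| + n)`, whose `n` is
cancelled by `q^(-n|k|)`. -/
theorem term_eq {n : ℕ} {q : ℂ} (hq : q ≠ 0) (α : ℂ) {x : Fin n → ℂ} (w : (Fin n → ℕ) → ℂ)
    {a : Fin n → ℂ} {M : Fin n → ℕ} (ha : ∀ s, a s = q ^ (M s + 1)) (k : Fin n → ℕ) :
    term q α x w a k = multiBinom q x M k * q ^ (size M * size k) *
      ((1 - α * q ^ (2 * size k)) * qPoch q α (size k) /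
        ((1 - α) * qPoch q (α * q ^ (size M + 1)) (size k))) * innerSum q α x w k := by
  have h1 : outerFactor q x a k = q ^ ((size M + n) * size k) *
      ∏ r, ∏ s, qPoch q (q ^ (-(M s : ℤ)) * (x r / x s)) (k r) := by
    have h2 : ∀ r s, ∏ i ∈ Finset.range (k r), (a s - q ^ (i + 1) * (x r / x s)) =
        (q ^ (M s + 1)) ^ k r * qPoch q (q ^ (-(M s : ℤ)) * (x r / x s)) (k r) := by
      intro r s
      rw [qPoch, ← Finset.card_range (k r), ← Finset.prod_const, Finset.card_range,
        ← Finset.prod_mul_distrib]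
      refine Finset.prod_congr rfl fun i _ => ?_
      have := pow_ne_zero (M s) hq
      rw [ha s, zpow_neg, zpow_natCast, pow_succ q (M s)]
      field_simp
      ring
    have h3 : q ^ ((size M + n) * size k) = ∏ r, ∏ s, (q ^ (M s + 1)) ^ k r := by
      rw [mul_comm, mul_comm, pow_mul, size, size, ← Finset.prod_pow_eq_pow_sum]
      refine Finset.prod_congr rfl fun r _ => ?_
      rw [Finset.prod_pow, Finset.prod_pow_eq_pow_sum, Finset.sum_add_distrib]
      simp
    rw [h3, ← Finset.prod_mul_distrib, outerFactor]
    refine Finset.prod_congr rfl fun r _ => ?_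
    rw [← Finset.prod_mul_distrib]
    exact Finset.prod_congr rfl fun s _ => h2 r s
  have h4 : q ^ ((∑ r : Fin n, ((r : ℕ) : ℤ) * (k r : ℤ)) - (n : ℤ) * (size k : ℤ)) *
      q ^ ((size M + n) * size k) =
      q ^ (∑ r : Fin n, (r : ℕ) * k r) * q ^ (size M * size k) := by
    rw [← pow_add, ← zpow_natCast, ← zpow_natCast, ← zpow_add₀ hq]
    congr 1
    push_cast
    ring
  rw [term, prod_mul_zpow hq α ha, h1, multiBinom]
  simp only [Finset.prod_div_distrib]
  generalize innerSum q α x w k = I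
  generalize (1 - α * q ^ (2 * size k)) * qPoch q α (size k) /
        ((1 - α) * qPoch q (α * q ^ (size M + 1)) (size k)) = Q
  rw [mul_div_assoc]
  generalize (∏ r, ∏ s, qPoch q (q ^ (-(M s : ℤ)) * (x r / x s)) (k r)) /
    (∏ r, ∏ s, qPoch q (q * (x r / x s)) (k r)) = P
  linear_combination vand q x k * P * Q * I * h4

/-- Orthogonality of the two matrices in the `A_n` Bailey inversion. -/
theorem orthogonality {n : ℕ} {q α : ℂ} (hq0 : 0 < ‖q‖) (hq1 : ‖q‖ < 1) (hα : α ≠ 1)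
    {x : Fin n → ℂ} (hx0 : ∀ r, x r ≠ 0) (hx : ∀ r s, r ≠ s → ∀ j : ℤ, x r ≠ q ^ j * x s)
    {M m : Fin n → ℕ} (hD : ∀ j : ℕ, α * q ^ (size M + 1) * q ^ j ≠ 1) (hm : m ≤ M) :
    ∑ k ∈ Finset.Iic M, multiBinom q x M k * q ^ (size M * size k) *
      ((1 - α * q ^ (2 * size k)) * qPoch q α (size k) /
        ((1 - α) * qPoch q (α * q ^ (size M + 1)) (size k))) *
      (multiBinom q x k m * q ^ size m * qPoch q (α * q ^ size k) (size m)) =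
    if m = M then qPoch q (α * q) (size M) else 0 := by
  have hq : q ≠ 0 := norm_pos_iff.1 hq0
  have hα' : 1 - α ≠ 0 := sub_ne_zero.2 hα.symm
  split_ifs with hmM
  · subst hmM
    -- On the diagonal triangularity leaves only `k = m`; the square of `multiBinom q x m m` cancels
    -- the powers of `q`.
    rw [Finset.sum_eq_single m]
    · have h1 := multiBinom_self hq0 hq1 hx0 hx m
      have h2 : ((-1 : ℂ) ^ size m * q ^ (size m * (size m + 1) / 2)) ^ 2 =
          q ^ (size m * size m) * q ^ size m := by
        rw [mul_pow, ← pow_mul, ← pow_mul, mul_comm (size m) 2, pow_mul, neg_one_sq, one_pow,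
          one_mul, ← pow_add, Nat.div_mul_cancel (Nat.even_mul_succ_self _).two_dvd]
        rfl
      have h3 : multiBinom q x m m ^ 2 * (q ^ (size m * size m) * q ^ size m) = 1 := by
        rw [← h2, ← mul_pow, h1, one_pow]
      have h4 : qPoch q (α * q ^ (size m + 1)) (size m) ≠ 0 := qPoch_ne_zero fun j _ => hD j
      have h5 : (1 - α * q ^ (2 * size m)) *
          (qPoch q α (size m) * qPoch q (α * q ^ size m) (size m)) =
          (1 - α) * (qPoch q (α * q) (size m) * qPoch q (α * q ^ (size m + 1)) (size m)) := by
        have : α * q ^ (size m + 1) = α * q * q ^ size m := by ring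
        rw [← qPoch_add, this, ← qPoch_add, ← qPoch_succ', ← two_mul, qPoch_succ, mul_comm]
      have h6 : (1 - α * q ^ (2 * size m)) * qPoch q α (size m) /
          ((1 - α) * qPoch q (α * q ^ (size m + 1)) (size m)) *
          qPoch q (α * q ^ size m) (size m) = qPoch q (α * q) (size m) := by
        rw [div_mul_eq_mul_div, div_eq_iff (mul_ne_zero hα' h4)]
        linear_combination h5
      linear_combination multiBinom q x m m ^ 2 * (q ^ (size m * size m) * q ^ size m) * h6 +
        qPoch q (α * q) (size m) * h3
    · intro k hk hne
      by_cases h : m ≤ k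
      · exact absurd (le_antisymm (Finset.mem_Iic.1 hk) h) hne
      · rw [multiBinom_eq_zero hq hx0 h]; ring
    · intro h; exact absurd (Finset.mem_Iic.2 le_rfl) h
  · have hlt : size m < size M :=
      Finset.sum_lt_sum (fun r _ => hm r) (by
        by_contra hc
        push Not at hc
        exact hmM (le_antisymm hm fun r => hc r (Finset.mem_univ r)))
    -- Off the diagonal all other factors depend on `k` only through `|k|`, so each fibre of `size`
    -- is a convolution.
    rw [← Finset.sum_fiberwise_of_maps_to (t := Finset.range (size M + 1)) (g := size)
      (fun k hk => Finset.mem_range.2 (Nat.lt_succ_of_le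
        (Finset.sum_le_sum fun r _ => Finset.mem_Iic.1 hk r)))]
    set τ : ℕ → ℂ := fun K => ((-1) ^ K * q ^ (K * (K + 1) / 2))⁻¹ * q ^ (size M * K) *
      convCoeff q (size m) K (size M - K) with hτ
    have hin : ∀ K ∈ Finset.range (size M + 1), ∑ k ∈ Finset.Iic M with size k = K,
        multiBinom q x M k * q ^ (size M * size k) *
          ((1 - α * q ^ (2 * size k)) * qPoch q α (size k) /
            ((1 - α) * qPoch q (α * q ^ (size M + 1)) (size k))) *
          (multiBinom q x k m * q ^ size m * qPoch q (α * q ^ size k) (size m)) =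
        (1 - α * q ^ (2 * K)) * qPoch q α (K + size m) /
          qPoch q (α * q ^ (size M + 1)) K * τ K *
          ((1 - α)⁻¹ * q ^ size m * multiBinom q x M m) := by
      intro K hK
      have hc := multiBinom_convolution hq0 hq1 hx0 hx M m K (size M - K) M le_rfl
        (by have := Finset.mem_range.1 hK; omega)
      have : ∀ k ∈ (Finset.Iic M).filter (fun k => size k = K),
          multiBinom q x M k * q ^ (size M * size k) *
          ((1 - α * q ^ (2 * size k)) * qPoch q α (size k) /
            ((1 - α) * qPoch q (α * q ^ (size M + 1)) (size k))) *
          (multiBinom q x k m * q ^ size m * qPoch q (α * q ^ size k) (size m)) =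
          (q ^ (size M * K) * ((1 - α * q ^ (2 * K)) * qPoch q α (K + size m) /
            ((1 - α) * qPoch q (α * q ^ (size M + 1)) K)) * q ^ size m) *
          (multiBinom q x M k * multiBinom q x k m) := by
        intro k hk
        rw [(Finset.mem_filter.1 hk).2, qPoch_add]
        ring
      rw [Finset.sum_congr rfl this, ← Finset.mul_sum, hc, hτ]
      simp only [div_eq_mul_inv, mul_inv]
      ring
    rw [Finset.sum_congr rfl hin, ← Finset.sum_mul]
    have h0 : τ 0 * (1 - q ^ size m) = 0 := by
      by_cases hl : size m = 0
      · simp [hl]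
      -- The factor `j = |m| - 1` has exponent `0`, and it is in range because `|m| < |M|`.
      · have : convCoeff q (size m) 0 (size M - 0) = 0 :=
          Finset.prod_eq_zero (i := size m - 1) (Finset.mem_range.2 (by omega)) (by
            have : (size m : ℤ) - (0 : ℕ) - 1 - (size m - 1 : ℕ) = 0 := by omega
            rw [this]; simp)
        simp only [hτ, this]; ring
    have h1 := sum_telescope τ h0 (fun K hK => convCoeff_step hq0 hq1 hK) hD (size M) le_rfl
    -- At `J = |M|` the closed form contains `q^|M| - q^|M|`, while `q^|M| ≠ q^|m|` on the other
    -- side.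
    rw [sub_self, mul_zero, mul_eq_zero] at h1
    rcases h1 with h1 | h1
    · rw [h1, zero_mul]
    · exfalso
      refine zpow_ne_one hq0 hq1 (j := (size M : ℤ) - size m) (by omega) ?_
      rw [zpow_sub₀ hq, zpow_natCast, zpow_natCast, sub_eq_zero.1 h1,
        div_self (pow_ne_zero _ hq)]

/-! ### From orthogonality to the expansion -/

theorem sum_term_eq {n : ℕ} {q α : ℂ} (hq0 : 0 < ‖q‖) (hq1 : ‖q‖ < 1) (hα : α ≠ 1)
    {x : Fin n → ℂ} (hx0 : ∀ r, x r ≠ 0) (hx : ∀ r s, r ≠ s → ∀ j : ℤ, x r ≠ q ^ j * x s)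
    (w : (Fin n → ℕ) → ℂ) {a : Fin n → ℂ} {M : Fin n → ℕ} (ha : ∀ s, a s = q ^ (M s + 1))
    (hD : ∀ j : ℕ, α * q ^ (size M + 1) * q ^ j ≠ 1) :
    ∑ k ∈ Finset.Iic M, term q α x w a k = qPoch q (α * q) (size M) * w M := by
  have hq : q ≠ 0 := norm_pos_iff.1 hq0
  have h1 : ∀ k ∈ Finset.Iic M, term q α x w a k = ∑ m ∈ Finset.Iic M,
      multiBinom q x M k * q ^ (size M * size k) *
      ((1 - α * q ^ (2 * size k)) * qPoch q α (size k) /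
        ((1 - α) * qPoch q (α * q ^ (size M + 1)) (size k))) *
      (multiBinom q x k m * q ^ size m * qPoch q (α * q ^ size k) (size m)) * w m := by
    intro k hk
    rw [term_eq hq α w ha, innerSum_eq, Finset.mul_sum]
    -- Enlarging `m ≤ k` to `m ≤ M` adds only zeros and makes the two sums interchangeable.
    rw [Finset.sum_subset (Finset.Iic_subset_Iic.2 (Finset.mem_Iic.1 hk))]
    · exact Finset.sum_congr rfl fun m _ => by ring
    · intro m _ hm
      rw [multiBinom_eq_zero hq hx0 (fun h => hm (Finset.mem_Iic.2 h))]
      ring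
  rw [Finset.sum_congr rfl h1, Finset.sum_comm, Finset.sum_eq_single M]
  · rw [← Finset.sum_mul, orthogonality hq0 hq1 hα hx0 hx hD le_rfl, if_pos rfl]
  · intro m hm hne
    rw [← Finset.sum_mul, orthogonality hq0 hq1 hα hx0 hx hD (Finset.mem_Iic.1 hm), if_neg hne,
      zero_mul]
  · intro h; exact absurd (Finset.mem_Iic.2 le_rfl) h

/-- The expansion holds as soon as `L` has the right values at the points `a_r = q^{M_r + 1}`. -/
theorem expansion_of_eq {n : ℕ} {q α : ℂ} (hq0 : 0 < ‖q‖) (hq1 : ‖q‖ < 1) (hα : α ≠ 1)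
    {x : Fin n → ℂ} (hx0 : ∀ r, x r ≠ 0) (hx : ∀ r s, r ≠ s → ∀ j : ℤ, x r ≠ q ^ j * x s)
    {w : (Fin n → ℕ) → ℂ} {L : (Fin n → ℂ) → ℂ}
    (hL : ∀ (M : Fin n → ℕ) (a : Fin n → ℂ), (∀ s, a s = q ^ (M s + 1)) →
      (∀ j : ℕ, α * q ^ (size M + 1) * q ^ j ≠ 1) → L a = qPoch q (α * q) (size M) * w M) :
    Expansion q α x w L := by
  have hq : q ≠ 0 := norm_pos_iff.1 hq0
  have hterm : ∀ N : Fin n → ℕ, (∀ r, 1 ≤ N r) →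
      ∀ a : Fin n → ℂ, (∀ r, a r = q ^ N r) → DenomNeZero q α a →
      (∀ k : Fin n → ℕ, (∃ r, N r ≤ k r) → term q α x w a k = 0) ∧
      HasSum (term q α x w a) (L a) := by
    intro N hN a ha hD
    obtain ⟨M, rfl⟩ : ∃ M : Fin n → ℕ, N = fun r => M r + 1 :=
      ⟨fun r => N r - 1, funext fun r => by have := hN r; dsimp only; omega⟩
    have hz : ∀ k : Fin n → ℕ, (∃ r, M r + 1 ≤ k r) → term q α x w a k = 0 := by
      rintro k ⟨r, hr⟩
      rw [term_eq hq α w ha, multiBinom_eq_zero hq hx0 (fun h => by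
        have h3 : k r ≤ M r := h r
        omega)]
      ring
    have hD' : ∀ j : ℕ, α * q ^ (size M + 1) * q ^ j ≠ 1 := fun j => by
      rw [← prod_mul_zpow hq α ha]; exact hD j
    refine ⟨hz, ?_⟩
    rw [hL M a ha hD', ← sum_term_eq hq0 hq1 hα hx0 hx w ha hD']
    refine hasSum_sum_of_ne_finset_zero fun k hk => hz k ?_
    rw [Finset.mem_Iic, Pi.le_def] at hk
    push Not at hk
    exact hk
  refine ⟨fun ρ hρ hD hLa hs hTa a ha => ?_, hterm⟩
  -- The terminating case shows that the difference of the two analytic sides vanishes at every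
  -- `q^N` in the polydisc.
  have h := eq_zero_of_eq_zero_qpow hq0 hq1 hρ (hTa.sub hLa) (fun N hN hNρ => by
    have h := (hterm N hN _ (fun r => rfl) (hD _ hNρ)).2
    simp only [Pi.sub_apply, h.tsum_eq, sub_self]) a ha
  have h2 : ∑' k, term q α x w a k = L a := sub_eq_zero.1 h
  rw [← h2]
  exact (hs a ha).of_norm.hasSum

theorem qPochInf_div {q : ℂ} (hq : ‖q‖ < 1) {z : ℂ} {m : ℕ} (hz : ∀ j : ℕ, z * q ^ m * q ^ j ≠ 1) :
    qPochInf q z / qPochInf q (z * q ^ m) = qPoch q z m := by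
  rw [← qPoch_mul_qPochInf hq z m, mul_div_cancel_right₀ _ (qPochInf_ne_zero hq hz)]

theorem qPochInf_div_self {q : ℂ} (hq : ‖q‖ < 1) {z : ℂ} (m : ℕ) (hz : ∀ j : ℕ, z * q ^ j ≠ 1) :
    qPochInf q (z * q ^ m) / qPochInf q z = (qPoch q z m)⁻¹ := by
  rw [← inv_div, qPochInf_div hq fun j => by rw [mul_assoc, ← pow_add]; exact hz _]

end Liu

/-! ### The four choices of `L` and `w` -/

theorem theorem1p3 (n : ℕ) (hn : 1 ≤ n) (q : ℂ) (hq0 : 0 < ‖q‖) (hq1 : ‖q‖ < 1)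
    (α b : ℂ) (hα : α ≠ 1) (x : Fin n → ℂ) (hx0 : ∀ r, x r ≠ 0)
    (hx : ∀ r s, r ≠ s → ∀ j : ℤ, x r ≠ q ^ j * x s) :
    ((∀ j : ℕ, α * b * q ^ j ≠ 1) →
      (∀ f : ℂ → ℂ,
        Liu.Expansion q α x
          (fun m => f (α * q ^ (1 + Liu.size m)) / Liu.qPoch q (α * b) (Liu.size m))
          (fun a => f (α * (∏ r, a r) * q ^ (1 - (n : ℤ))) *
            ((Liu.qPochInf q (α * q) * Liu.qPochInf q (α * (∏ r, a r) * b / q ^ n)) /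
              (Liu.qPochInf q (α * (∏ r, a r) * q ^ (1 - (n : ℤ))) *
                Liu.qPochInf q (α * b))))) ∧
      (∀ f : (Fin n → ℂ) → ℂ,
        Liu.Expansion q α x
          (fun m => f (fun r => α * q ^ (1 + m r)) / Liu.qPoch q (α * b) (Liu.size m))
          (fun a => f (fun r => α * a r) *
            ((Liu.qPochInf q (α * q) * Liu.qPochInf q (α * (∏ r, a r) * b / q ^ n)) /
              (Liu.qPochInf q (α * b) *
                Liu.qPochInf q (α * (∏ r, a r) * q ^ (1 - (n : ℤ)))))))) ∧
    ((∀ r, ∀ j : ℕ, α * b * x r * q ^ j ≠ 1) →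
      (∀ f : ℂ → ℂ,
        Liu.Expansion q α x
          (fun m => f (α * q ^ (1 + Liu.size m)) / ∏ r, Liu.qPoch q (α * b * x r) (m r))
          (fun a => f (α * (∏ r, a r) * q ^ (1 - (n : ℤ))) *
            (Liu.qPochInf q (α * q) /
              Liu.qPochInf q (α * (∏ r, a r) * q ^ (1 - (n : ℤ)))) *
            ∏ r, Liu.qPochInf q (α * a r * b * x r / q) / Liu.qPochInf q (α * b * x r))) ∧
      (∀ f : (Fin n → ℂ) → ℂ,
        Liu.Expansion q α x
          (fun m => f (fun r => α * q ^ (1 + m r)) / ∏ r, Liu.qPoch q (α * b * x r) (m r))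
          (fun a => f (fun r => α * a r) *
            (Liu.qPochInf q (α * q) /
              Liu.qPochInf q (α * (∏ r, a r) * q ^ (1 - (n : ℤ)))) *
            ∏ r, Liu.qPochInf q (α * a r * b * x r / q) /
              Liu.qPochInf q (α * b * x r)))) := by
  have hq : q ≠ 0 := norm_pos_iff.1 hq0
  have hratio : ∀ M : Fin n → ℕ, (∀ j : ℕ, α * q ^ (Liu.size M + 1) * q ^ j ≠ 1) →
      Liu.qPochInf q (α * q) / Liu.qPochInf q (α * q ^ (Liu.size M + 1)) =
        Liu.qPoch q (α * q) (Liu.size M) := by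
    intro M hD
    have e : α * q ^ (Liu.size M + 1) = α * q * q ^ Liu.size M := by ring
    rw [e] at hD ⊢
    exact Liu.qPochInf_div hq1 hD
  have hprod : ∀ (M : Fin n → ℕ) (a : Fin n → ℂ), (∀ s, a s = q ^ (M s + 1)) →
      α * (∏ r, a r) * b / q ^ n = α * b * q ^ Liu.size M := by
    intro M a ha
    have h : ∏ s, a s = q ^ Liu.size M * q ^ n := by
      rw [Finset.prod_congr rfl fun s _ => ha s, Finset.prod_pow_eq_pow_sum,
        Finset.sum_add_distrib, ← pow_add]
      simp [Liu.size]
    have := pow_ne_zero n hq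
    rw [h]
    field_simp
  have hpt : ∀ (M : Fin n → ℕ) (a : Fin n → ℂ), (∀ s, a s = q ^ (M s + 1)) →
      (fun r => α * a r) = fun r => α * q ^ (1 + M r) :=
    fun M a ha => funext fun r => by rw [ha r, add_comm]
  refine ⟨fun hb => ⟨fun f => ?_, fun f => ?_⟩, fun hb => ⟨fun f => ?_, fun f => ?_⟩⟩ <;>
    refine Liu.expansion_of_eq hq0 hq1 hα hx0 hx fun M a ha hD => ?_
  · rw [Liu.prod_mul_zpow hq α ha, hprod M a ha, mul_div_mul_comm, hratio M hD,
      Liu.qPochInf_div_self hq1 _ hb, add_comm (Liu.size M) 1]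
    ring
  · rw [Liu.prod_mul_zpow hq α ha, hprod M a ha, mul_comm (Liu.qPochInf q (α * b)),
      mul_div_mul_comm, hratio M hD, Liu.qPochInf_div_self hq1 _ hb, hpt M a ha]
    ring
  all_goals
    -- Since `a_r / q = q^(M_r)`, the products telescope separately in each coordinate, rather than
    -- through `|M|` as in the first two cases.
    have hx' : ∏ r, Liu.qPochInf q (α * a r * b * x r / q) / Liu.qPochInf q (α * b * x r) =
        (∏ r, Liu.qPoch q (α * b * x r) (M r))⁻¹ := by
      rw [← Finset.prod_inv_distrib]
      refine Finset.prod_congr rfl fun r _ => ?_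
      rw [← Liu.qPochInf_div_self hq1 _ (hb r)]
      congr 2
      rw [ha r, pow_succ]
      field_simp
  · rw [Liu.prod_mul_zpow hq α ha, hratio M hD, hx', add_comm (Liu.size M) 1]
    ring
  · rw [Liu.prod_mul_zpow hq α ha, hratio M hD, hx', hpt M a ha]
    ring
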